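/- Setting. The queue has the methods $\mathtt{enq}$ and $\mathtt{deq}$ over the natural numbers and a distinguished symbol $\mathtt{NULL}\notin\mathbb N$. Its events are $\mathtt{enq}(x)$ ($x\in\mathbb N$) and $\mathtt{deq}(v)$ ($v\in\mathbb N\cup\{\mathtt{NULL}\}$), each carrying a unique identifier. An event $a$ generates an invocation $inv(a)$ (an enqueue invocation carries the input, a dequeue invocation carries no value) and a response $res(a)$ (a dequeue response carries the returned value). A history is a finite sequence of such actions; it is well-formed if each identifier has at most one invocation and at most one response and every response occurs after its matching invocation. A history is complete if every invocation in it has a matching response in it. We write $a\prec_c b$ if $res(a)$ occurs before $inv(b)$ in $c$, and $\mathrm{Enq}(c)$, $\mathrm{Deq}(c)$ for the sets of enqueue and dequeue events of $c$. A behavior (a sequence of events with distinct identifiers) is a legal queue behavior if it is the trace of a run, starting in the empty sequence, of the transition system on finite sequences $q$ over $\mathbb N$ with the transitions $q\xrightarrow{\mathtt{enq}(x)}q\cdot x$, $\;x\cdot q\xrightarrow{\mathtt{deq}(x)}q$ and $\varepsilon\xrightarrow{\mathtt{deq}(\mathtt{NULL})}\varepsilon$. A history $c$ is linearizable with respect to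 the queue if there are a completion $\hat c$ of $c$ (a well-formed complete history obtained by appending response actions to $c$ and then deleting the pending events) and a legal queue behavior whose sequential history $s$ (each invocation immediately followed by its response) is a permutation of $\hat c$ such that $a\prec_{\hat c}b$ implies $a\prec_s b$ for all events $a,b$ of $\hat c$. Proposition. Let $c$ be a well-formed complete history in which each value is enqueued at most once. Then $c$ is linearizable with respect to the queue if and only if it has none of the following four violations: * (VFresh) there is a value $x\neq\mathtt{NULL}$ with $\mathtt{deq}(x)\in\mathrm{Deq}(c)$ such that $\mathtt{enq}(x)\notin\mathrm{Enq}(c)$ or $\mathtt{deq}(x)\prec_c\mathtt{enq}(x)$; * (VRepet) there are two distinct events in $\mathrm{Deq}(c)$ that return the same value, different from $\mathtt{NULL}$; * (VOrd) there are values $x,y\in\mathbb N$ with $\mathtt{enq}(y)\prec_c\mathtt{enq}(x)$ and $\mathtt{deq}(x)\in\mathrm{Deq}(c)$ such that $\mathtt{deq}(y)\notin\mathrm{Deq}(c)$ or $\mathtt{deq}(x)\prec_c\mathtt{deq}(y)$; * (VWit) there is a dequeue event $d\in\mathrm{Deq}(c)$ returning $\mathtt{NULL}$ such that, writing $c=c_0\cdot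 inv(d)\cdot c_d\cdot res(d)\cdot c_3$, for every splitting $c_d=c_1\cdot c_2$ there is an event $\mathtt{enq}(x)\in\mathrm{Enq}(c)$ that is completed in (both its actions occur in) $c_0\cdot inv(d)\cdot c_1$ while no dequeue event of $c$ that returns $x$ has its invocation in $c_0\cdot inv(d)\cdot c_1$. -/

import Mathlib

namespace QueueLin

/-- Events of the queue: `enq uid x` enqueues the natural number `x`; `deq uid v` is a dequeue
returning `v`, where `none` is the distinguished value NULL and `some x` is the number `x`.
The first argument is the unique event identifier. -/
inductive Event where
  | enq (uid : ℕ) (x : ℕ)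
  | deq (uid : ℕ) (v : Option ℕ)

/-- Invocation and response actions. An enqueue takes an input and returns nothing, a dequeue takes
no input and returns a value. The identifier pairs an invocation with its response. -/
inductive Action where
  | enqInv (uid : ℕ) (x : ℕ)
  | enqRes (uid : ℕ)
  | deqInv (uid : ℕ)
  | deqRes (uid : ℕ) (v : Option ℕ)

namespace Action

def uid : Action → ℕ
  | enqInv u _ => u
  | enqRes u => u
  | deqInv u => u
  | deqRes u _ => u

def isInv : Action → Bool
  | enqInv _ _ => true
  | enqRes _ => false
  | deqInv _ => true
  | deqRes _ _ => false

end Action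

namespace Event

def uid : Event → ℕ
  | enq u _ => u
  | deq u _ => u

/-- The invocation action generated by an event. -/
def inv : Event → Action
  | enq u x => Action.enqInv u x
  | deq u _ => Action.deqInv u

/-- The response action generated by an event. -/
def res : Event → Action
  | enq u _ => Action.enqRes u
  | deq u v => Action.deqRes u v

/-- The value enqueued or dequeued by an event (`none` is NULL). -/
def val : Event → Option ℕ
  | enq _ x => some x
  | deq _ v => v

def IsEnq : Event → Prop
  | enq _ _ => True
  | deq _ _ => False

def IsDeq : Event → Prop
  | enq _ _ => False
  | deq _ _ => True

end Event

/-! ### Behaviors and the queue semantics -/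

/-- A behavior is a sequence of events whose identifiers are pairwise distinct. -/
def IsBehavior (b : List Event) : Prop := (b.map Event.uid).Nodup

/-- Transitions of the labelled transition system of the queue; states are sequences of numbers. -/
inductive Step : List ℕ → Event → List ℕ → Prop
  | enq (q : List ℕ) (u x : ℕ) : Step q (Event.enq u x) (q ++ [x])
  | deq (q : List ℕ) (u x : ℕ) : Step (x :: q) (Event.deq u (some x)) q
  | deqNull (u : ℕ) : Step [] (Event.deq u none) []

/-- `Run q b q'`: there is a run from state `q` to state `q'` with trace `b`. -/
inductive Run : List ℕ → List Event → List ℕ → Prop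
  | nil (q : List ℕ) : Run q [] q
  | cons {q q' q'' : List ℕ} {a : Event} {b : List Event} :
      Step q a q' → Run q' b q'' → Run q (a :: b) q''

/-- The legal queue behaviors: traces of runs that start in the empty queue. -/
def queueBehaviors : Set (List Event) := {b | IsBehavior b ∧ ∃ q, Run [] b q}

/-! ### Histories -/

/-- A history is a finite sequence of actions. -/
abbrev History := List Action

/-- Every identifier has at most one invocation and at most one response, and every response
occurs after its matching invocation. -/
def WellFormed (c : History) : Prop :=
  (c.map fun a => (a.uid, a.isInv)).Nodup ∧
  ∀ c₁ c₂ a, c = c₁ ++ a :: c₂ → a.isInv = false → ∃ e : Event, e.res = a ∧ e.inv ∈ c₁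

/-- An event is completed in `c` if both its actions occur in `c`. -/
def Completed (c : History) (e : Event) : Prop := e.inv ∈ c ∧ e.res ∈ c

/-- The action `a` is the invocation of a pending event of `c`: it occurs in `c`, and
no matching response does. -/
def IsPendingInv (c : History) (a : Action) : Prop :=
  a ∈ c ∧ a.isInv = true ∧ ∀ e : Event, e.inv = a → e.res ∉ c

/-- A history is complete if it has no pending events. -/
def Complete (c : History) : Prop := ∀ a, ¬ IsPendingInv c a

open Classical in
/-- The subsequence of `c` in which the pending events are removed. -/
noncomputable def removePending (c : History) : History :=
  c.filter fun a => decide (¬ IsPendingInv c a)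

/-- The completions of `c`. -/
def completions (c : History) : Set History :=
  {c' | WellFormed c' ∧ Complete c' ∧
    ∃ r : History, (∀ a ∈ r, a.isInv = false) ∧ c' = removePending (c ++ r)}

/-- `e` precedes `e'` in `h`: the response of `e` occurs before the invocation of `e'`. -/
def Precedes (h : History) (e e' : Event) : Prop :=
  ∃ i j : ℕ, i < j ∧ h[i]? = some e.res ∧ h[j]? = some e'.inv

/-- Each invocation is immediately followed by its matching response, except possibly for
an invocation at the very end. -/
def Sequential (s : History) : Prop :=
  ∀ s₁ s₂ a, s = s₁ ++ a :: s₂ → a.isInv = true →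
    s₂ = [] ∨ ∃ (e : Event) (s₃ : History), e.inv = a ∧ s₂ = e.res :: s₃

/-- `s` is a linearization of `c`. -/
def IsLinearization (s c : History) : Prop :=
  WellFormed s ∧ Sequential s ∧ ∃ c' ∈ completions c, c'.Perm s ∧
    ∀ e e', Completed c' e → Completed c' e' → Precedes c' e e' → Precedes s e e'

/-- The complete sequential history that is identified with a behavior. -/
def behaviorHistory (b : List Event) : History := b.flatMap fun e => [e.inv, e.res]

/-- `c` is linearizable with respect to the data structure whose legal behaviors are `L`:
some linearization of `c` is (identified with) a legal behavior. -/
def Linearizable (L : Set (List Event)) (c : History) : Prop :=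
  ∃ b ∈ L, IsLinearization (behaviorHistory b) c

/-! ### Events of complete histories and the four violations -/

/-- The enqueue events of a complete history `c` (in a complete history, the invoked events are
exactly the completed ones). -/
def Enq (c : History) : Set Event := {e | e.IsEnq ∧ Completed c e}

/-- The dequeue events of a complete history `c`; the returned value is the one in the response. -/
def Deq (c : History) : Set Event := {d | d.IsDeq ∧ Completed c d}

/-- Each value is enqueued at most once in `c`. -/
def EnqueuedAtMostOnce (c : History) : Prop :=
  ∀ e ∈ Enq c, ∀ e' ∈ Enq c, e.val = e'.val → e = e'

/-- A dequeue event returns a value `x` (not NULL) such that `enq(x)` does not occur in `c`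
or is preceded by the dequeue event. -/
def VFresh (c : History) : Prop :=
  ∃ x : ℕ, ∃ d ∈ Deq c, d.val = some x ∧
    ((¬ ∃ e ∈ Enq c, e.val = some x) ∨ ∃ e ∈ Enq c, e.val = some x ∧ Precedes c d e)

/-- Two dequeue events return the same value, different from NULL. -/
def VRepet (c : History) : Prop :=
  ∃ d ∈ Deq c, ∃ d' ∈ Deq c, d ≠ d' ∧ d.val = d'.val ∧ d.val ≠ none

/-- `enq(y)` precedes `enq(x)`, the value `x` is dequeued, and `y` is not dequeued or
`deq(x)` precedes `deq(y)`. -/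
def VOrd (c : History) : Prop :=
  ∃ x y : ℕ, ∃ ey ∈ Enq c, ∃ ex ∈ Enq c, ∃ dx ∈ Deq c,
    ey.val = some y ∧ ex.val = some x ∧ dx.val = some x ∧ Precedes c ey ex ∧
    ((¬ ∃ dy ∈ Deq c, dy.val = some y) ∨ ∃ dy ∈ Deq c, dy.val = some y ∧ Precedes c dx dy)

/-- Some dequeue event `d` returns NULL although, at every point `p = c₀ · inv(d) · c₁` of its
execution, there is an enqueue event completed in `p` for whose value no dequeue event
has been invoked in `p`. -/
def VWit (c : History) : Prop :=
  ∃ d ∈ Deq c, d.val = none ∧ ∃ c₀ cd c₃ : History,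
    c = c₀ ++ [d.inv] ++ cd ++ [d.res] ++ c₃ ∧
    ∀ c₁ c₂ : History, cd = c₁ ++ c₂ →
      ∃ e ∈ Enq c, Completed (c₀ ++ [d.inv] ++ c₁) e ∧
        ∀ d' ∈ Deq c, d'.val = e.val → d'.inv ∉ c₀ ++ [d.inv] ++ c₁

end QueueLin

namespace QueueLin

/-! A well-formed complete history is its own only completion, so linearizability asks for an
enumeration of its events that extends real-time precedence and is a queue trace.

Necessity: along a run from the empty queue, the enqueued sequence is the dequeued sequence followed
by the current queue (`Run.append_enqs`). With distinct values this excludes the first three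
violations. For VWit, cut the history right after the last invocation among the NULL dequeue and the
events linearized before it. An enqueue completed by then is linearized before the NULL dequeue, so
its value is returned by an event already invoked.

Sufficiency: the action at position `i` gets time `2 * i + 1`, and the gap before position `k` gets
time `2 * k`. Each enqueue has a window for itself and one for its dequeue; the absence of VWit
gives each NULL dequeue a single gap at which the queue may be empty, serving as both windows. A
queue order is a ranking of these items along which enqueue points and dequeue points both increase.
The greedy argument of `exists_schedule` finds one unless two items have enqueue windows in one
strict order and dequeue windows in the other; the absence of VOrd and the choice of the gaps rule
this out (`interval_compatible`). Sorting the events by time, then rank, then enqueue before dequeue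
gives the linearization. -/

theorem Event.eq_of_inv_eq_of_res_eq {e e' : Event} (hi : e.inv = e'.inv) (hr : e.res = e'.res) :
    e = e' := by
  cases e <;> cases e' <;> simp_all [Event.inv, Event.res]

@[simp] theorem Event.uid_inv (e : Event) : e.inv.uid = e.uid := by cases e <;> rfl
@[simp] theorem Event.uid_res (e : Event) : e.res.uid = e.uid := by cases e <;> rfl
@[simp] theorem Event.isInv_inv (e : Event) : e.inv.isInv = true := by cases e <;> rfl
@[simp] theorem Event.isInv_res (e : Event) : e.res.isInv = false := by cases e <;> rfl

theorem Event.inv_ne_res (e e' : Event) : e.inv ≠ e'.res := fun h => by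
  simpa using congrArg Action.isInv h

/-! ### Well-formed complete histories and their completions -/

section WellFormed

variable {c : History}

theorem WellFormed.nodup (h : WellFormed c) : c.Nodup := List.Nodup.of_map _ h.1

theorem WellFormed.eq_of_key (h : WellFormed c) {a a' : Action} (ha : a ∈ c) (ha' : a' ∈ c)
    (hu : a.uid = a'.uid) (hi : a.isInv = a'.isInv) : a = a' :=
  List.inj_on_of_nodup_map h.1 ha ha' (by simp [hu, hi])

theorem WellFormed.eq_of_uid (h : WellFormed c) {e e' : Event} (he : Completed c e)
    (he' : Completed c e') (hu : e.uid = e'.uid) : e = e' :=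
  Event.eq_of_inv_eq_of_res_eq (h.eq_of_key he.1 he'.1 (by simpa) (by simp))
    (h.eq_of_key he.2 he'.2 (by simpa) (by simp))

/-- In a complete history, every action belongs to a completed event. -/
theorem WellFormed.exists_completed (h : WellFormed c) (hc : Complete c) {a : Action}
    (ha : a ∈ c) : ∃ e, Completed c e ∧ (e.inv = a ∨ e.res = a) := by
  cases hi : a.isInv with
  | true =>
    have := hc a
    simp only [IsPendingInv, ha, hi, true_and, not_forall, not_not] at this
    obtain ⟨e, rfl, he⟩ := this
    exact ⟨e, ⟨ha, he⟩, Or.inl rfl⟩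
  | false =>
    obtain ⟨s, t, rfl⟩ := List.append_of_mem ha
    obtain ⟨e, rfl, he⟩ := h.2 s t a rfl hi
    exact ⟨e, ⟨by simp [he], ha⟩, Or.inr rfl⟩

theorem removePending_append_responses (hc : Complete c) {r : History}
    (hr : ∀ a ∈ r, a.isInv = false) : removePending (c ++ r) = c ++ r := by
  classical
  rw [removePending, List.filter_eq_self]
  intro a ha
  simp only [decide_eq_true_eq]
  rintro ⟨-, hi, hp⟩
  rcases List.mem_append.1 ha with ha | ha
  · exact hc a ⟨ha, hi, fun e he hm => hp e he (by simp [hm])⟩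
  · simp [hr a ha] at hi

/-- A well-formed complete history is its only completion. -/
theorem completions_eq_singleton (h : WellFormed c) (hc : Complete c) : completions c = {c} := by
  ext c'
  simp only [completions, Set.mem_ofPred_eq, Set.mem_singleton_iff]
  constructor
  · rintro ⟨hw, -, r, hr, rfl⟩
    rw [removePending_append_responses hc hr] at hw ⊢
    rcases r with _ | ⟨a, r⟩
    · simp
    exfalso
    have hi : a.isInv = false := hr a (by simp)
    obtain ⟨e, rfl, he⟩ := hw.2 c r a rfl hi
    -- The invocation matching the appended response is already answered in `c`, so the response
    -- would occur twice.
    obtain ⟨e', he', h1 | h1⟩ := h.exists_completed hc he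
    · have hu : e.uid = e'.uid := by simpa using congrArg Action.uid h1.symm
      have := hw.eq_of_key (a := e'.res) (a' := e.res) (by simp [he'.2]) (by simp)
        (by simp [hu]) (by simp)
      have hn := hw.nodup
      rw [List.nodup_append] at hn
      exact hn.2.2 _ he'.2 _ (by simp) this
    · exact Event.inv_ne_res _ _ h1.symm
  · rintro rfl
    exact ⟨h, hc, [], by simp, by rw [removePending_append_responses hc (by simp)]; simp⟩

end WellFormed

/-! ### Positions of actions in a history -/

section Positions

open Classical in
/-- The position of an action in a history. -/
noncomputable def pos (c : History) (a : Action) : ℕ := c.idxOf a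

variable {c : History}

theorem pos_lt_length {a : Action} (h : a ∈ c) : pos c a < c.length := by
  classical exact List.idxOf_lt_length_of_mem h

theorem getElem_pos_eq_some {a : Action} (h : a ∈ c) : (c)[pos c a]? = some a := by
  classical
  have h' : pos c a < c.length := pos_lt_length h
  rw [List.getElem?_eq_getElem h']
  simp [pos]

theorem pos_eq_of_getElem_eq_some (hn : c.Nodup) {a : Action} {i : ℕ} (h : (c)[i]? = some a) :
    pos c a = i := by
  have hm : a ∈ c := List.mem_of_getElem? h
  have h1 := getElem_pos_eq_some hm
  exact (List.getElem?_inj (pos_lt_length hm) hn).1 (h1.trans h.symm)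

theorem pos_inj {a a' : Action} (h : a ∈ c) (h' : a' ∈ c) (hp : pos c a = pos c a') :
    a = a' := by
  have := getElem_pos_eq_some h
  rw [hp, getElem_pos_eq_some h'] at this
  simpa using this.symm

theorem precedes_iff (hn : c.Nodup) {e e' : Event} (h : e.res ∈ c) (h' : e'.inv ∈ c) :
    Precedes c e e' ↔ pos c e.res < pos c e'.inv := by
  constructor
  · rintro ⟨i, j, hij, hi, hj⟩
    rwa [pos_eq_of_getElem_eq_some hn hi, pos_eq_of_getElem_eq_some hn hj]
  · exact fun hlt => ⟨_, _, hlt, getElem_pos_eq_some h, getElem_pos_eq_some h'⟩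

theorem mem_prefix_iff (hn : c.Nodup) {s t : History} (hc : c = s ++ t) {a : Action}
    (ha : a ∈ c) : a ∈ s ↔ pos c a < s.length := by
  constructor
  · intro h
    obtain ⟨i, hi, rfl⟩ := List.getElem_of_mem h
    rwa [pos_eq_of_getElem_eq_some hn (i := i)]
    rw [hc, List.getElem?_append_left hi, List.getElem?_eq_getElem hi]
  · intro h
    have := getElem_pos_eq_some ha
    rw [hc, List.getElem?_append_left (by rwa [← hc]), ← hc] at this
    exact List.mem_of_getElem? this

theorem pos_mid (hn : c.Nodup) {s t : History} {a : Action} (hc : c = s ++ a :: t) :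
    pos c a = s.length :=
  pos_eq_of_getElem_eq_some hn (by simp [hc])

theorem WellFormed.pos_inv_lt (h : WellFormed c) {e : Event} (he : Completed c e) :
    pos c e.inv < pos c e.res := by
  obtain ⟨s, t, hs⟩ := List.append_of_mem he.2
  -- An enqueue response carries no value, so `e'` need not be `e` at first; uniqueness of the
  -- identifier identifies their invocations.
  obtain ⟨e', hr, hi⟩ := h.2 s t _ hs (by simp)
  have hu : e'.uid = e.uid := by simpa using congrArg Action.uid hr
  have hee : e'.inv = e.inv := h.eq_of_key (by simp [hs, hi]) he.1 (by simpa) (by simp)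
  rw [pos_mid h.nodup hs, ← mem_prefix_iff h.nodup hs he.1, ← hee]
  exact hi

end Positions

/-! ### Sequential histories of behaviors -/

section Behavior

theorem mem_behaviorHistory {b : List Event} {a : Action} :
    a ∈ behaviorHistory b ↔ ∃ e ∈ b, a = e.inv ∨ a = e.res := by
  simp [behaviorHistory]

/-- The action carrying the value determines the event: the invocation of an enqueue, the response
of a dequeue. -/
theorem completed_behaviorHistory {b : List Event} {e : Event} :
    Completed (behaviorHistory b) e ↔ e ∈ b := by
  constructor
  · rintro ⟨hi, hr⟩
    cases e with
    | enq u x =>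
      obtain ⟨e', he', h | h⟩ := mem_behaviorHistory.1 hi <;> cases e' <;>
        simp_all [Event.inv, Event.res]
    | deq u v =>
      obtain ⟨e', he', h | h⟩ := mem_behaviorHistory.1 hr <;> cases e' <;>
        simp_all [Event.inv, Event.res]
  · exact fun h => ⟨mem_behaviorHistory.2 ⟨e, h, .inl rfl⟩, mem_behaviorHistory.2 ⟨e, h, .inr rfl⟩⟩

theorem IsBehavior.wellFormed {b : List Event} (hb : IsBehavior b) :
    WellFormed (behaviorHistory b) := by
  have hkeys : ((behaviorHistory b).map fun a => (a.uid, a.isInv)).Nodup := by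
    induction b with
    | nil => simp [behaviorHistory]
    | cons e b ih =>
      simp only [IsBehavior, List.map_cons, List.nodup_cons, List.mem_map, not_exists,
        not_and] at hb
      have := ih hb.2
      simp only [behaviorHistory, List.flatMap_cons, List.cons_append, List.nil_append,
        List.map_cons, List.nodup_cons, Event.uid_inv, Event.uid_res, Event.isInv_inv,
        Event.isInv_res] at this ⊢
      refine ⟨?_, ?_, this⟩ <;>
      · simp only [List.mem_cons, List.mem_map, List.mem_flatMap, not_or, not_exists, not_and]
        try simp only [Prod.mk.injEq, not_and]
        simp
        try rintro a x hx (rfl | rfl) h <;> simp_all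
  refine ⟨hkeys, fun s t a hs hi => ?_⟩
  have ha : a ∈ behaviorHistory b := by simp [hs]
  obtain ⟨e, he, rfl | rfl⟩ := mem_behaviorHistory.1 ha
  · simp at hi
  refine ⟨e, rfl, ?_⟩
  obtain ⟨p, q, rfl⟩ := List.append_of_mem he
  have hs' : behaviorHistory (p ++ e :: q) =
      (behaviorHistory p ++ [e.inv]) ++ e.res :: behaviorHistory q := by
    simp [behaviorHistory, List.flatMap_append]
  have hl := (pos_mid hkeys.of_map hs).symm.trans (pos_mid hkeys.of_map hs')
  rw [(List.append_inj (hs.symm.trans hs') hl).1]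
  simp

theorem behaviorHistory_sequential (b : List Event) : Sequential (behaviorHistory b) := by
  induction b with
  | nil => intro s t a h; simp [behaviorHistory] at h
  | cons e b ih =>
    intro s t a h hi
    change e.inv :: e.res :: behaviorHistory b = _ at h
    rcases s with _ | ⟨x, _ | ⟨y, s⟩⟩
    · simp only [List.nil_append, List.cons.injEq] at h
      exact .inr ⟨e, _, h.1, h.2.symm⟩
    · simp only [List.cons_append, List.nil_append, List.cons.injEq] at h
      rw [← h.2.1] at hi
      simp at hi
    · simp only [List.cons_append, List.cons.injEq] at h
      exact ih s t a h.2.2 hi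

theorem precedes_of_split {p q r : List Event} (e e' : Event) :
    Precedes (behaviorHistory (p ++ e :: q ++ e' :: r)) e e' := by
  refine ⟨(behaviorHistory p).length + 1, (behaviorHistory p).length + 2 +
    (behaviorHistory q).length, by omega, ?_, ?_⟩
  · simp [behaviorHistory, List.flatMap_append]
  · have : behaviorHistory (p ++ e :: q ++ e' :: r) =
        (behaviorHistory p ++ [e.inv, e.res] ++ behaviorHistory q) ++
          e'.inv :: e'.res :: behaviorHistory r := by
      simp [behaviorHistory, List.flatMap_append]
    have hl : (behaviorHistory p).length + 2 + (behaviorHistory q).length =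
        (behaviorHistory p ++ [e.inv, e.res] ++ behaviorHistory q).length := by
      simp only [List.length_append, List.length_cons, List.length_nil]
    rw [this, hl, List.getElem?_append_right le_rfl]
    simp

/-- Precedence in the history of a behavior is the order of the events in the behavior. -/
theorem IsBehavior.mem_of_precedes {b p q : List Event} (hb : IsBehavior b) {e e' : Event}
    (hs : b = p ++ e' :: q) (he : e ∈ b) (h : Precedes (behaviorHistory b) e e') : e ∈ p := by
  have hw := hb.wellFormed
  have he'b : e' ∈ b := by simp [hs]
  have hc := completed_behaviorHistory.2 he
  have hc' := completed_behaviorHistory.2 he'b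
  rw [precedes_iff hw.nodup hc.2 hc'.1] at h
  have h1 := hw.pos_inv_lt hc
  have h2 := hw.pos_inv_lt hc'
  rw [hs, List.mem_append, List.mem_cons] at he
  rcases he with he | rfl | he
  · exact he
  · omega
  · obtain ⟨q₁, q₂, rfl⟩ := List.append_of_mem he
    have h3 : Precedes (behaviorHistory b) e' e := by
      rw [hs]; simpa using precedes_of_split (p := p) (q := q₁) (r := q₂) e' e
    rw [precedes_iff hw.nodup hc'.2 hc.1] at h3
    omega

end Behavior

/-! ### Runs of the queue and the FIFO invariant -/

section Semantics

/-- The value enqueued by an event. -/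
def enqValue : Event → Option ℕ
  | .enq _ x => some x
  | .deq _ _ => none

/-- The number dequeued by an event. -/
def deqValue : Event → Option ℕ
  | .enq _ _ => none
  | .deq _ v => v

/-- The values enqueued in a behavior, in order. -/
def enqs (b : List Event) : List ℕ := b.filterMap enqValue

/-- The numbers dequeued in a behavior, in order. -/
def deqs (b : List Event) : List ℕ := b.filterMap deqValue

@[simp] theorem enqs_append (b b' : List Event) : enqs (b ++ b') = enqs b ++ enqs b' :=
  List.filterMap_append
@[simp] theorem deqs_append (b b' : List Event) : deqs (b ++ b') = deqs b ++ deqs b' :=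
  List.filterMap_append
@[simp] theorem enqs_nil : enqs [] = [] := rfl
@[simp] theorem deqs_nil : deqs [] = [] := rfl
@[simp] theorem enqs_cons_enq (u x : ℕ) (b : List Event) : enqs (.enq u x :: b) = x :: enqs b := rfl
@[simp] theorem enqs_cons_deq (u : ℕ) (v : Option ℕ) (b : List Event) :
    enqs (.deq u v :: b) = enqs b := rfl
@[simp] theorem deqs_cons_enq (u x : ℕ) (b : List Event) : deqs (.enq u x :: b) = deqs b := rfl
@[simp] theorem deqs_cons_deq_some (u x : ℕ) (b : List Event) :
    deqs (.deq u (some x) :: b) = x :: deqs b := rfl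
@[simp] theorem deqs_cons_deq_none (u : ℕ) (b : List Event) :
    deqs (.deq u none :: b) = deqs b := rfl

theorem mem_enqs {b : List Event} {x : ℕ} : x ∈ enqs b ↔ ∃ u, .enq u x ∈ b := by
  simp only [enqs, List.mem_filterMap]
  constructor
  · rintro ⟨_ | _, h, h'⟩ <;> simp [enqValue] at h'
    exact ⟨_, h' ▸ h⟩
  · exact fun ⟨u, h⟩ => ⟨_, h, rfl⟩

theorem mem_deqs {b : List Event} {x : ℕ} : x ∈ deqs b ↔ ∃ u, .deq u (some x) ∈ b := by
  simp only [deqs, List.mem_filterMap]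
  constructor
  · rintro ⟨_ | _, h, h'⟩ <;> simp [deqValue] at h'
    exact ⟨_, h' ▸ h⟩
  · exact fun ⟨u, h⟩ => ⟨_, h, rfl⟩

theorem Run.append {q q' q'' : List ℕ} {b b' : List Event} (h : Run q b q') (h' : Run q' b' q'') :
    Run q (b ++ b') q'' := by
  induction h with
  | nil => exact h'
  | cons hs _ ih => exact .cons hs (ih h')

theorem Run.exists_of_append {q q'' : List ℕ} {b b' : List Event} (h : Run q (b ++ b') q'') :
    ∃ q', Run q b q' ∧ Run q' b' q'' := by
  induction b generalizing q with
  | nil => exact ⟨q, .nil q, h⟩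
  | cons a b ih =>
    cases h with
    | cons hs h =>
      obtain ⟨q', h1, h2⟩ := ih h
      exact ⟨q', .cons hs h1, h2⟩

/-- Transitions only append on the right and remove on the left. From the empty queue this makes the
dequeued sequence a prefix of the enqueued one. -/
theorem Run.append_enqs {q q' : List ℕ} {b : List Event} (h : Run q b q') :
    q ++ enqs b = deqs b ++ q' := by
  induction h with
  | nil => simp
  | cons hs _ ih => cases hs <;> simpa using ih

/-- In a run, the number returned by a dequeue is the oldest one that was not dequeued before. -/
theorem Run.exists_of_deq {b p r : List Event} {q : List ℕ} {u x : ℕ} (h : Run [] b q)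
    (hb : b = p ++ .deq u (some x) :: r) : ∃ l, enqs p = deqs p ++ x :: l := by
  subst hb
  obtain ⟨q', h1, h2⟩ := h.exists_of_append
  cases h2 with
  | cons hs _ => cases hs; exact ⟨_, by simpa using h1.append_enqs⟩

theorem Run.enqs_eq_deqs_of_null {b p r : List Event} {q : List ℕ} {u : ℕ} (h : Run [] b q)
    (hb : b = p ++ .deq u none :: r) : enqs p = deqs p := by
  subst hb
  obtain ⟨q', h1, h2⟩ := h.exists_of_append
  cases h2 with
  | cons hs _ => cases hs; simpa using h1.append_enqs

/-- The queue reached after a behavior in which no value is enqueued twice. -/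
def remaining (b : List Event) : List ℕ := (enqs b).filter (· ∉ deqs b)

/-- A sufficient condition for a sequence of events to be the trace of a run from the empty
queue. -/
theorem run_of_prefix_conditions {b : List Event}
    (henq : ∀ p r u x, b = p ++ .enq u x :: r → x ∉ deqs p)
    (hdeq : ∀ p r u x, b = p ++ .deq u (some x) :: r →
      x ∉ deqs p ∧ ∃ l₁ l₂, enqs p = l₁ ++ x :: l₂ ∧ (∀ y ∈ l₁, y ∈ deqs p) ∧ x ∉ l₂)
    (hnull : ∀ p r u, b = p ++ .deq u none :: r → ∀ y ∈ enqs p, y ∈ deqs p) :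
    Run [] b (remaining b) := by
  induction b using List.reverseRecOn with
  | nil => exact .nil _
  | append_singleton b a ih =>
    have ih := ih (fun p r u x h => henq p (r ++ [a]) u x (by simp [h]))
      (fun p r u x h => hdeq p (r ++ [a]) u x (by simp [h]))
      (fun p r u h => hnull p (r ++ [a]) u (by simp [h]))
    refine ih.append (.cons ?_ (.nil _))
    rcases a with ⟨u, x⟩ | ⟨u, _ | x⟩
    · have hx := henq b [] u x rfl
      -- Had `x` been dequeued earlier, the filter would discard the new occurrence; `henq` prevents
      -- this.
      have : remaining (b ++ [.enq u x]) = remaining b ++ [x] := by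
        simp [remaining, List.filter_append, hx]
      rw [this]
      exact .enq _ u x
    · have hx := hnull b [] u rfl
      have h1 : remaining b = [] := by simpa [remaining] using hx
      have h2 : remaining (b ++ [.deq u none]) = [] := by simpa [remaining] using hx
      rw [h1, h2]
      exact .deqNull u
    · obtain ⟨hx, l₁, l₂, h1, h2, h3⟩ := hdeq b [] u x rfl
      -- Everything enqueued before `x` is gone and `x` does not recur after it, so dequeuing `x`
      -- removes exactly the head.
      have hr : remaining b = x :: remaining (b ++ [.deq u (some x)]) := by
        have e1 : l₁.filter (fun y => y ∉ deqs b) = [] := by simpa using h2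
        have e2 : l₁.filter (fun y => y ∉ deqs b ++ [x]) = [] := by
          simp only [List.filter_eq_nil_iff]
          intro y hy
          simp [h2 y hy]
        have e3 : l₂.filter (fun y => y ∉ deqs b ++ [x]) = l₂.filter (fun y => y ∉ deqs b) := by
          refine List.filter_congr fun y hy => ?_
          have : y ≠ x := fun h => h3 (h ▸ hy)
          simp [this]
        simp only [remaining, enqs_append, deqs_append, enqs_cons_deq, enqs_nil, List.append_nil,
          deqs_cons_deq_some, deqs_nil, h1, List.filter_append, e1, e2, List.filter_cons, e3]
        simp [hx]
      rw [hr]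
      exact .deq _ u x

end Semantics

/-! ### Linearizable histories have no violation -/

section Necessity

variable {c : History} {b : List Event}

theorem enq_mem_Enq {u x : ℕ} : .enq u x ∈ Enq c ↔ Completed c (.enq u x) := by
  simp [Enq, Event.IsEnq]

theorem deq_mem_Deq {u : ℕ} {v : Option ℕ} : .deq u v ∈ Deq c ↔ Completed c (.deq u v) := by
  simp [Deq, Event.IsDeq]

theorem exists_eq_enq {e : Event} {x : ℕ} (he : e ∈ Enq c) (hx : e.val = some x) :
    ∃ u, e = .enq u x := by
  rcases e with ⟨u, y⟩ | ⟨u, v⟩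
  · exact ⟨u, by simpa [Event.val] using hx⟩
  · exact he.1.elim

theorem exists_eq_deq {e : Event} {v : Option ℕ} (he : e ∈ Deq c) (hv : e.val = v) :
    ∃ u, e = .deq u v := by
  rcases e with ⟨u, y⟩ | ⟨u, w⟩
  · exact he.1.elim
  · exact ⟨u, by simpa [Event.val] using hv⟩

theorem nodup_filterMap_of_inj {α β : Type*} {f : α → Option β} {l : List α} (hl : l.Nodup)
    (hf : ∀ a ∈ l, ∀ a' ∈ l, ∀ x, f a = some x → f a' = some x → a = a') :
    (l.filterMap f).Nodup := by
  induction l with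
  | nil => simp
  | cons a l ih =>
    rw [List.nodup_cons] at hl
    have ih := ih hl.2 fun a ha a' ha' => hf a (by simp [ha]) a' (by simp [ha'])
    rw [List.filterMap_cons]
    split
    · exact ih
    · rename_i x hx
      rw [List.nodup_cons]
      refine ⟨fun h => ?_, ih⟩
      obtain ⟨a', ha', hx'⟩ := List.mem_filterMap.1 h
      exact hl.1 (hf a (by simp) a' (by simp [ha']) x hx hx' ▸ ha')

theorem notMem_of_nodup_append_cons {α : Type*} {p r : List α} {a : α}
    (h : (p ++ a :: r).Nodup) : a ∉ p :=
  fun ha => (List.nodup_append.1 h).2.2 a ha a (by simp) rfl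

theorem enqs_nodup (hb : b.Nodup) (hm : ∀ e, Completed c e ↔ e ∈ b)
    (honce : EnqueuedAtMostOnce c) : (enqs b).Nodup := by
  refine nodup_filterMap_of_inj hb fun e he e' he' x hx hx' => ?_
  rcases e with _ | _ <;> simp [enqValue] at hx
  rcases e' with _ | _ <;> simp [enqValue] at hx'
  exact honce _ (enq_mem_Enq.2 ((hm _).2 he)) _ (enq_mem_Enq.2 ((hm _).2 he')) (by simp [Event.val, *])

variable {q : List ℕ} (hrun : Run [] b q) (hm : ∀ e, Completed c e ↔ e ∈ b)
  (hbb : b.Nodup) (honce : EnqueuedAtMostOnce c)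
  (hprec : ∀ p r e e', b = p ++ e' :: r → e ∈ b → Precedes c e e' → e ∈ p)
include hrun hm hbb honce

/-- The dequeued sequence is a prefix of the enqueued one, which has no repetition. -/
theorem deqs_nodup : (deqs b).Nodup := by
  have h := enqs_nodup hbb hm honce
  have := hrun.append_enqs
  rw [List.nil_append] at this
  rw [this] at h
  exact h.of_append_left

theorem not_vRepet : ¬ VRepet c := by
  rintro ⟨d, hd, d', hd', hne, hv, hn⟩
  obtain ⟨x, hx⟩ := Option.ne_none_iff_exists'.1 hn
  obtain ⟨u, rfl⟩ := exists_eq_deq hd hx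
  obtain ⟨u', rfl⟩ := exists_eq_deq hd' (hv.symm.trans hx)
  have h1 := (hm _).1 (deq_mem_Deq.1 hd)
  have h2 := (hm _).1 (deq_mem_Deq.1 hd')
  obtain ⟨p, r, hp⟩ := List.append_of_mem h1
  have hdn := deqs_nodup hrun hm hbb honce
  rw [hp] at h2 hdn
  simp only [deqs_append, deqs_cons_deq_some, List.nodup_append, List.nodup_cons] at hdn
  simp only [List.mem_append, List.mem_cons] at h2
  rcases h2 with h2 | h2 | h2
  · exact hdn.2.2 x (mem_deqs.2 ⟨u', h2⟩) x (by simp) rfl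
  · exact hne h2.symm
  · exact hdn.2.1.1 (mem_deqs.2 ⟨u', h2⟩)

include hprec

theorem not_vFresh : ¬ VFresh c := by
  rintro ⟨x, d, hd, hx, h⟩
  obtain ⟨u, rfl⟩ := exists_eq_deq hd hx
  have h1 := (hm _).1 (deq_mem_Deq.1 hd)
  obtain ⟨p, r, hp⟩ := List.append_of_mem h1
  obtain ⟨l, hl⟩ := hrun.exists_of_deq hp
  obtain ⟨w, hw⟩ := mem_enqs.1 (show x ∈ enqs p by simp [hl])
  have hwc : .enq w x ∈ Enq c := enq_mem_Enq.2 ((hm _).2 (by simp [hp, hw]))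
  rcases h with h | ⟨e, he, hex, hpr⟩
  · exact h ⟨_, hwc, rfl⟩
  · obtain rfl := honce _ he _ hwc hex
    obtain ⟨p₁, p₂, rfl⟩ := List.append_of_mem hw
    have hmem := hprec p₁ (p₂ ++ .deq u (some x) :: r) _ _ (by simp [hp]) h1 hpr
    rw [hp] at hbb
    exact notMem_of_nodup_append_cons hbb (by simp [hmem])

theorem not_vOrd : ¬ VOrd c := by
  rintro ⟨x, y, ey, hey, ex, hex, dx, hdx, hy, hx, hxd, hpr, h⟩
  obtain ⟨u, rfl⟩ := exists_eq_deq hdx hxd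
  obtain ⟨w, rfl⟩ := exists_eq_enq hex hx
  obtain ⟨w', rfl⟩ := exists_eq_enq hey hy
  have h1 := (hm _).1 (deq_mem_Deq.1 hdx)
  obtain ⟨p, r, hp⟩ := List.append_of_mem h1
  obtain ⟨l, hl⟩ := hrun.exists_of_deq hp
  obtain ⟨w'', hw⟩ := mem_enqs.1 (show x ∈ enqs p by simp [hl])
  obtain rfl : w'' = w := by
    have hwb : .enq w'' x ∈ b := by simp [hp, hw]
    simpa using honce _ (enq_mem_Enq.2 ((hm _).2 hwb)) _ hex rfl
  obtain ⟨p₁, p₂, rfl⟩ := List.append_of_mem hw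
  have hmem := hprec p₁ (p₂ ++ .deq u (some x) :: r) _ _ (by simp [hp])
    ((hm _).1 (enq_mem_Enq.1 hey)) hpr
  have hn := enqs_nodup hbb hm honce
  rw [hp, enqs_append] at hn
  have hn := hn.of_append_left
  have hn' := hn
  rw [hl] at hn'
  have hyd : y ∈ deqs (p₁ ++ .enq w'' x :: p₂) := by
    have hy1 : y ∈ enqs p₁ := mem_enqs.2 ⟨_, hmem⟩
    rw [enqs_append, enqs_cons_enq] at hl hn
    -- Two decompositions of `enqs` around `x`; as `x` occurs only once, their left parts agree.
    have hlen : enqs p₁ = deqs (p₁ ++ .enq w'' x :: p₂) := by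
      rcases List.append_eq_append_iff.1 hl with ⟨a, ha, hb⟩ | ⟨a, ha, hb⟩
      · rcases a with _ | ⟨z, a⟩
        · simpa using ha.symm
        · simp only [List.cons_append, List.cons.injEq] at hb
          rw [ha, ← hb.1] at hn'
          simp [List.nodup_append] at hn'
      · rcases a with _ | ⟨z, a⟩
        · simpa using ha
        · simp only [List.cons_append, List.cons.injEq] at hb
          rw [ha, ← hb.1] at hn
          simp [List.nodup_append] at hn
    rwa [← hlen]
  obtain ⟨u', hu'⟩ := mem_deqs.1 hyd
  have hu'c : .deq u' (some y) ∈ Deq c := deq_mem_Deq.2 ((hm _).2 (by rw [hp]; exact List.mem_append_left _ hu'))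
  rcases h with h | ⟨dy, hdy, hdv, hpd⟩
  · exact h ⟨_, hu'c, rfl⟩
  · have hEq : dy = .deq u' (some y) := by
      by_contra hne
      exact not_vRepet hrun hm hbb honce ⟨dy, hdy, _, hu'c, hne, hdv, by simp [hdv]⟩
    subst hEq
    obtain ⟨s₁, s₂, hs⟩ := List.append_of_mem hu'
    rw [hs] at hp
    have hmem := hprec s₁ (s₂ ++ .deq u (some x) :: r) _ _ (by simp [hp]) h1 hpd
    rw [hp] at hbb
    exact notMem_of_nodup_append_cons hbb (by simp [hmem])

omit honce in
theorem not_vWit (hwf : WellFormed c) : ¬ VWit c := by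
  rintro ⟨d, hd, hv, c₀, cd, c₃, hc, h⟩
  obtain ⟨u, rfl⟩ := exists_eq_deq hd hv
  set d : Event := .deq u none with hdd
  have hdc : Completed c d := hd.2
  have hdb := (hm _).1 hdc
  obtain ⟨p, r, hp⟩ := List.append_of_mem hdb
  have heq := hrun.enqs_eq_deqs_of_null hp
  have hin : ∀ o ∈ p ++ [d], o ∈ b := fun o ho => by
    rw [hp]; simp only [List.mem_append, List.mem_cons, List.not_mem_nil, or_false] at ho ⊢; tauto
  -- The refuting splitting of `cd` ends with the last invocation among `d` and the events
  -- linearized before it.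
  obtain ⟨o, ho, hmax⟩ : ∃ o ∈ p ++ [d], ∀ o' ∈ p ++ [d], pos c o'.inv ≤ pos c o.inv := by
    classical
    obtain ⟨o, ho, h⟩ := (p ++ [d]).toFinset.exists_max_image (fun o => pos c o.inv)
      ⟨d, by simp⟩
    exact ⟨o, by simpa [or_comm] using ho, fun o' ho' => h o' (by simpa [or_comm] using ho')⟩
  have hoc := (hm o).2 (hin o ho)
  have hn := hwf.nodup
  have hres : pos c d.res = (c₀ ++ [d.inv] ++ cd).length := pos_mid hn (by simpa using hc)
  have hinv : pos c d.inv = c₀.length := pos_mid hn (t := cd ++ [d.res] ++ c₃) (by simpa using hc)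
  -- Otherwise `d` would precede `o` in real time, although `o` is linearized no later than `d`.
  have hlt : pos c o.inv < pos c d.res := by
    rcases List.mem_append.1 ho with ho | ho
    · by_contra hle
      have hne : pos c d.res ≠ pos c o.inv := fun h =>
        Event.inv_ne_res _ _ (pos_inj hdc.2 hoc.1 h).symm
      have hpr : Precedes c d o := (precedes_iff hn hdc.2 hoc.1).2 (by omega)
      obtain ⟨p₁, p₂, rfl⟩ := List.append_of_mem ho
      have hmem := hprec p₁ (p₂ ++ d :: r) d o (by simp [hp]) hdb hpr
      rw [hp] at hbb
      exact notMem_of_nodup_append_cons hbb (by simp [hmem])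
    · obtain rfl : o = d := by simpa using ho
      exact hwf.pos_inv_lt hdc
  have hge := hmax d (by simp)
  obtain ⟨e, he, hec, hno⟩ := h (cd.take (pos c o.inv - c₀.length)) _ (List.take_append_drop _ _).symm
  set k := pos c o.inv - c₀.length with hk
  have hcut : c = (c₀ ++ [d.inv] ++ cd.take k) ++ (cd.drop k ++ [d.res] ++ c₃) := by
    conv_lhs => rw [hc, ← List.take_append_drop k cd]
    simp only [List.append_assoc]
  have hlen : (c₀ ++ [d.inv] ++ cd.take k).length = pos c o.inv + 1 := by
    simp only [List.length_append, List.length_cons, List.length_nil, List.length_take] at hres ⊢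
    omega
  -- The cut ends with an invocation, so an event completed within it responds before `o` is invoked
  -- and is linearized before `o`.
  have hep : e ∈ p := by
    have h1 := (mem_prefix_iff hn hcut he.2.2).1 hec.2
    rw [hlen] at h1
    have hne : pos c e.res ≠ pos c o.inv := fun h =>
        Event.inv_ne_res _ _ (pos_inj he.2.2 hoc.1 h).symm
    have hpr : Precedes c e o := (precedes_iff hn he.2.2 hoc.1).2 (by omega)
    rcases List.mem_append.1 ho with ho | ho
    · obtain ⟨p₁, p₂, rfl⟩ := List.append_of_mem ho
      have hmem := hprec p₁ (p₂ ++ d :: r) e o (by simp [hp]) ((hm _).1 he.2) hpr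
      simp [hmem]
    · obtain rfl : o = d := by simpa using ho
      exact hprec p r e _ hp ((hm _).1 he.2) hpr
  rcases e with ⟨w, x⟩ | ⟨w, v⟩
  swap
  · exact he.1
  obtain ⟨w', hw'⟩ := mem_deqs.1 (heq ▸ mem_enqs.2 ⟨w, hep⟩ : x ∈ deqs p)
  have hw'c := (hm (.deq w' (some x))).2 (hin _ (by simp [hw']))
  refine hno _ (deq_mem_Deq.2 hw'c) rfl ?_
  rw [mem_prefix_iff hn hcut hw'c.1, hlen]
  have := hmax _ (show .deq w' (some x) ∈ p ++ [d] by simp [hw'])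
  omega

end Necessity

theorem Linearizable.not_violations {c : History} (hwf : WellFormed c) (hcomplete : Complete c)
    (honce : EnqueuedAtMostOnce c) (h : Linearizable queueBehaviors c) :
    ¬ VFresh c ∧ ¬ VRepet c ∧ ¬ VOrd c ∧ ¬ VWit c := by
  obtain ⟨b, ⟨hb, q, hrun⟩, -, -, c', hc', hperm, hpr⟩ := h
  rw [completions_eq_singleton hwf hcomplete, Set.mem_singleton_iff] at hc'
  subst hc'
  have hm : ∀ e, Completed c' e ↔ e ∈ b := fun e => by
    rw [← completed_behaviorHistory, Completed, Completed, hperm.mem_iff, hperm.mem_iff]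
  have hbb : b.Nodup := List.Nodup.of_map _ hb
  have hprec : ∀ p r e e', b = p ++ e' :: r → e ∈ b → Precedes c' e e' → e ∈ p :=
    fun p r e e' hs he hp => hb.mem_of_precedes hs he
      (hpr e e' ((hm e).2 he) ((hm e').2 (by simp [hs])) hp)
  exact ⟨not_vFresh hrun hm hbb honce hprec, not_vRepet hrun hm hbb honce,
    not_vOrd hrun hm hbb honce hprec, not_vWit hrun hm hbb hprec hwf⟩


/-! ### Greedy scheduling of paired intervals -/

section Schedule

/-- Items with an interval `[e₁, e₂]` for their enqueue and an interval `[d₁, d₂]` for their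
dequeue can be ranked, and points chosen in all intervals, such that the enqueue points and the
dequeue points are both monotone in the rank, provided no enqueue interval lies before another
one while their dequeue intervals are in the opposite order. -/
theorem exists_schedule {ι : Type*} (S : Finset ι) (e₁ e₂ d₁ d₂ : ι → ℕ)
    (he : ∀ v ∈ S, e₁ v ≤ e₂ v) (hd : ∀ v ∈ S, d₁ v ≤ d₂ v) (hed : ∀ v ∈ S, e₁ v ≤ d₁ v)
    (hno : ∀ v ∈ S, ∀ w ∈ S, e₂ v < e₁ w → d₁ v ≤ d₂ w) :
    ∃ rank tE tD : ι → ℕ, Set.InjOn rank S ∧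
      (∀ v ∈ S, e₁ v ≤ tE v ∧ tE v ≤ e₂ v ∧ d₁ v ≤ tD v ∧ tD v ≤ d₂ v ∧ tE v ≤ tD v) ∧
      ∀ v ∈ S, ∀ w ∈ S, rank v ≤ rank w → tE v ≤ tE w ∧ tD v ≤ tD w := by
  classical
  induction S using Finset.strongInduction with
  | H S ih =>
    rcases S.eq_empty_or_nonempty with rfl | hne
    · exact ⟨fun _ => 0, fun _ => 0, fun _ => 0, by simp⟩
    -- An item that can go first in both orders: `a` has the earliest enqueue deadline, `b` the
    -- earliest dequeue deadline. If `a` is blocked by the dequeue deadline of `b`, then `hno` shows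
    -- that `b` is not blocked by the enqueue deadline of `a`.
    obtain ⟨m, hm, hmin⟩ : ∃ m ∈ S, ∀ w ∈ S, e₁ m ≤ e₂ w ∧ d₁ m ≤ d₂ w := by
      obtain ⟨a, ha, hamin⟩ := S.exists_min_image e₂ hne
      obtain ⟨b, hb, hbmin⟩ := S.exists_min_image d₂ hne
      by_cases h : d₁ a ≤ d₂ b
      · exact ⟨a, ha, fun w hw => ⟨(he a ha).trans (hamin w hw), h.trans (hbmin w hw)⟩⟩
      · refine ⟨b, hb, fun w hw => ⟨?_, (hd b hb).trans (hbmin w hw)⟩⟩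
        have := mt (hno a ha b hb) h
        exact (not_lt.1 this).trans (hamin w hw)
    have hsub : ∀ v ∈ S.erase m, v ∈ S := fun v => Finset.mem_of_mem_erase
    obtain ⟨rank, tE, tD, hinj, hpt, hmono⟩ := ih (S.erase m) (Finset.erase_ssubset hm)
      (fun v hv => he v (hsub v hv)) (fun v hv => hd v (hsub v hv))
      (fun v hv => hed v (hsub v hv)) (fun v hv w hw => hno v (hsub v hv) w (hsub w hw))
    -- `m` takes its earliest points and the others are raised to at least these; by `hmin` they
    -- stay within their deadlines.
    refine ⟨fun v => if v = m then 0 else rank v + 1,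
      fun v => if v = m then e₁ m else max (tE v) (e₁ m),
      fun v => if v = m then d₁ m else max (tD v) (d₁ m), ?_, ?_, ?_⟩
    · intro v hv w hw h
      by_cases hvm : v = m <;> by_cases hwm : w = m <;> simp [hvm, hwm] at h ⊢
      exact hinj (by simpa [hvm] using hv) (by simpa [hwm] using hw) h
    · intro v hv
      by_cases hvm : v = m
      · subst hvm
        simpa using ⟨he v hv, hd v hv, hed v hv⟩
      · have h1 := hpt v (by simp [hvm, hv])
        have h2 := hmin v hv
        have h3 := hed m hm
        simp only [if_neg hvm]
        omega
    · intro v hv w hw h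
      by_cases hvm : v = m <;> by_cases hwm : w = m <;> simp [hvm, hwm] at h ⊢
      have := hmono v (by simp [hvm, hv]) w (by simp [hwm, hw]) h
      omega

theorem exists_sorted_list {α κ : Type*} [LinearOrder κ] (S : Finset α) (key : α → κ)
    (hkey : Set.InjOn key S) :
    ∃ l : List α, l.Pairwise (fun a b => key a < key b) ∧ ∀ a, a ∈ l ↔ a ∈ S := by
  classical
  induction S using Finset.strongInduction with
  | H S ih =>
    rcases S.eq_empty_or_nonempty with rfl | hne
    · exact ⟨[], by simp⟩
    obtain ⟨m, hm, hmin⟩ := S.exists_min_image key hne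
    obtain ⟨l, hl, hmem⟩ := ih (S.erase m) (Finset.erase_ssubset hm)
      (hkey.mono (by simp))
    refine ⟨m :: l, List.pairwise_cons.2 ⟨fun a ha => ?_, hl⟩, fun a => ?_⟩
    · have := (hmem a).1 ha
      rw [Finset.mem_erase] at this
      exact lt_of_le_of_ne (hmin a this.2) fun h => this.1 (hkey hm this.2 h).symm
    · rw [List.mem_cons, hmem, Finset.mem_erase]
      by_cases h : a = m <;> simp [h, hm]

theorem mem_prefix_iff_of_pairwise {α κ : Type*} [LinearOrder κ] {key : α → κ} {l p r : List α}
    {a : α} (hl : l.Pairwise fun a b => key a < key b) (h : l = p ++ a :: r) {o : α} :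
    o ∈ p ↔ o ∈ l ∧ key o < key a := by
  subst h
  rw [List.pairwise_append, List.pairwise_cons] at hl
  constructor
  · exact fun ho => ⟨by simp [ho], hl.2.2 o ho a (by simp)⟩
  · rintro ⟨ho, hlt⟩
    rcases List.mem_append.1 ho with ho | ho
    · exact ho
    rcases List.mem_cons.1 ho with rfl | ho
    · exact absurd hlt (lt_irrefl _)
    · exact absurd (hl.2.1.1 o ho) hlt.asymm

end Schedule

/-! ### From the absence of violations to a schedule -/

section Sufficiency

variable {c : History}

theorem finite_completed (hwf : WellFormed c) : {e | Completed c e}.Finite :=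
  Set.Finite.of_finite_image (f := Event.uid)
    ((c.map Action.uid).toFinset.finite_toSet.subset (by
      rintro _ ⟨e, he, rfl⟩
      simpa using ⟨e.inv, he.1, Event.uid_inv e⟩))
    fun _ he _ he' h => hwf.eq_of_uid he he' h

/-- A real-time respecting enumeration of the events of a complete history that is a legal
behavior is a linearization. -/
theorem linearizable_of_order (hwf : WellFormed c) (hcomplete : Complete c)
    {b : List Event} {q : List ℕ} (hrun : Run [] b q) (hbb : b.Nodup)
    (hm : ∀ e, e ∈ b ↔ Completed c e)
    (hord : ∀ p r e e', b = p ++ e' :: r → e ∈ b → Precedes c e e' → e ∈ p) :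
    Linearizable queueBehaviors c := by
  have hb : IsBehavior b := List.Nodup.map_on
    (fun e he e' he' h => hwf.eq_of_uid ((hm e).1 he) ((hm e').1 he') h) hbb
  refine ⟨b, ⟨hb, q, hrun⟩, hb.wellFormed, behaviorHistory_sequential b, c, ?_, ?_, ?_⟩
  · rw [completions_eq_singleton hwf hcomplete]; rfl
  · rw [List.perm_ext_iff_of_nodup hwf.nodup hb.wellFormed.nodup]
    intro a
    rw [mem_behaviorHistory]
    constructor
    · intro ha
      obtain ⟨e, he, h⟩ := hwf.exists_completed hcomplete ha
      exact ⟨e, (hm e).2 he, h.imp Eq.symm Eq.symm⟩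
    · rintro ⟨e, he, rfl | rfl⟩
      exacts [((hm e).1 he).1, ((hm e).1 he).2]
  · intro e e' he he' hpr
    obtain ⟨p, r, hp⟩ := List.append_of_mem ((hm e').2 he')
    obtain ⟨p₁, p₂, rfl⟩ := List.append_of_mem (hord p r e e' hp ((hm e).2 he) hpr)
    rw [hp]
    exact precedes_of_split e e'

/-- The events that occupy a place in the order of the queue: the enqueue events, and the dequeue
events that return NULL. -/
def IsItem (c : History) (e : Event) : Prop := Completed c e ∧ (e.IsEnq ∨ e.val = none)

/-- The intervals in which the enqueue and the dequeue of an item have to take place. -/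
structure IntervalSpec (c : History) (v : Event) (e₁ e₂ d₁ d₂ : ℕ) : Prop where
  enq_left : v.IsEnq → e₁ = 2 * pos c v.inv + 1
  dequeued : v.IsEnq → ∀ d ∈ Deq c, d.val = v.val →
    e₂ = min (2 * pos c v.res + 1) (2 * pos c d.res + 1) ∧
    d₁ = max (2 * pos c v.inv + 1) (2 * pos c d.inv + 1) ∧ d₂ = 2 * pos c d.res + 1
  not_dequeued : v.IsEnq → (¬ ∃ d ∈ Deq c, d.val = v.val) →
    e₂ = 2 * pos c v.res + 1 ∧ d₁ = 2 * c.length ∧ d₂ = 2 * c.length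
  null : v.val = none → ∃ k, e₁ = 2 * k ∧ e₂ = 2 * k ∧ d₁ = 2 * k ∧ d₂ = 2 * k ∧
    pos c v.inv < k ∧ k ≤ pos c v.res ∧
    ∀ e ∈ Enq c, pos c e.res < k → ∃ d ∈ Deq c, d.val = e.val ∧ pos c d.inv < k

/-- Here `k` is the length of a prefix `c₀ · inv(d) · c₁` at which the VWit condition fails, so `pos
< k` means lying in that prefix. -/
theorem exists_empty_point (hwf : WellFormed c) (hw : ¬ VWit c) {d : Event} (hd : d ∈ Deq c)
    (hv : d.val = none) : ∃ k, pos c d.inv < k ∧ k ≤ pos c d.res ∧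
      ∀ e ∈ Enq c, pos c e.res < k → ∃ d' ∈ Deq c, d'.val = e.val ∧ pos c d'.inv < k := by
  by_contra hcon
  push Not at hcon
  refine hw ⟨d, hd, hv, ?_⟩
  have hn := hwf.nodup
  obtain ⟨s, c₃, hs⟩ := List.append_of_mem hd.2.2
  have hlt := hwf.pos_inv_lt hd.2
  have hres := pos_mid hn hs
  have hi : d.inv ∈ s := by rw [mem_prefix_iff hn hs hd.2.1]; omega
  obtain ⟨c₀, cd, rfl⟩ := List.append_of_mem hi
  refine ⟨c₀, cd, c₃, by simp [hs], fun c₁ c₂ h12 => ?_⟩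
  subst h12
  have hinv : pos c d.inv = c₀.length :=
    pos_mid hn (t := c₁ ++ c₂ ++ d.res :: c₃) (by rw [hs]; simp)
  have hcut : c = (c₀ ++ [d.inv] ++ c₁) ++ (c₂ ++ d.res :: c₃) := by rw [hs]; simp
  obtain ⟨e, he, hlt, h⟩ := hcon (c₀ ++ [d.inv] ++ c₁).length
    (by rw [hinv]; simp) (by rw [hres]; simp)
  have hi := hwf.pos_inv_lt he.2
  refine ⟨e, he, ⟨(mem_prefix_iff hn hcut he.2.1).2 (by omega),
    (mem_prefix_iff hn hcut he.2.2).2 hlt⟩, fun d' hd' hdv hm => ?_⟩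
  have := h d' hd' hdv
  have := (mem_prefix_iff hn hcut hd'.2.1).1 hm
  omega

/-- The absence of VRepet makes the dequeue of a value unique, so the windows do not depend on a
choice. The time `2 * c.length`, later than every action, stands for never being dequeued. -/
theorem exists_intervals (hwf : WellFormed c) (hr : ¬ VRepet c) (hw : ¬ VWit c) {v : Event}
    (hv : IsItem c v) : ∃ e₁ e₂ d₁ d₂, IntervalSpec c v e₁ e₂ d₁ d₂ := by
  rcases v with ⟨u, x⟩ | ⟨u, y⟩
  · by_cases h : ∃ d ∈ Deq c, d.val = some x
    · obtain ⟨d, hd, hdv⟩ := h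
      refine ⟨2 * pos c (Event.enq u x).inv + 1,
        min (2 * pos c (Event.enq u x).res + 1) (2 * pos c d.res + 1),
        max (2 * pos c (Event.enq u x).inv + 1) (2 * pos c d.inv + 1), 2 * pos c d.res + 1,
        fun _ => rfl, fun _ d' hd' hdv' => ?_,
        fun _ h => (h ⟨d, hd, hdv⟩).elim, by simp [Event.val]⟩
      obtain rfl : d = d' := by
        by_contra hne
        exact hr ⟨d, hd, d', hd', hne, hdv.trans hdv'.symm, by simp [hdv]⟩
      exact ⟨rfl, rfl, rfl⟩
    · exact ⟨_, _, _, _, fun _ => rfl, fun _ d hd hdv => (h ⟨d, hd, hdv⟩).elim,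
        fun _ _ => ⟨rfl, rfl, rfl⟩, by simp [Event.val]⟩
  · have hy : y = none := by simpa [Event.IsEnq, Event.val] using hv.2
    subst hy
    obtain ⟨k, hk⟩ := exists_empty_point hwf hw (deq_mem_Deq.2 hv.1) rfl
    exact ⟨_, _, _, _, fun h => h.elim, fun h => h.elim, fun h => h.elim,
      fun _ => ⟨k, rfl, rfl, rfl, rfl, hk⟩⟩

theorem IsItem.mem_Enq_or_null {v : Event} (hv : IsItem c v) :
    v ∈ Enq c ∨ (v ∈ Deq c ∧ v.val = none) := by
  rcases v with ⟨u, x⟩ | ⟨u, y⟩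
  · exact .inl (enq_mem_Enq.2 hv.1)
  · exact .inr ⟨deq_mem_Deq.2 hv.1, by simpa [Event.IsEnq] using hv.2⟩

theorem pos_enq_inv_le (hwf : WellFormed c) (hf : ¬ VFresh c) {e d : Event} (he : e ∈ Enq c)
    (hd : d ∈ Deq c) (hv : d.val = e.val) : pos c e.inv ≤ pos c d.res := by
  rcases e with ⟨u, x⟩ | _
  swap
  · exact he.1.elim
  by_contra h
  exact hf ⟨x, d, hd, hv, .inr ⟨_, he, rfl,
    (precedes_iff hwf.nodup hd.2.2 he.2.1).2 (by omega)⟩⟩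

section

variable {e₁ e₂ d₁ d₂ : Event → ℕ} (hwf : WellFormed c) (hf : ¬ VFresh c)
  (hI : ∀ v, IsItem c v → IntervalSpec c v (e₁ v) (e₂ v) (d₁ v) (d₂ v))
include hwf hf hI

theorem interval_bounds {v : Event} (hv : IsItem c v) :
    e₁ v ≤ e₂ v ∧ d₁ v ≤ d₂ v ∧ e₁ v ≤ d₁ v := by
  have hs := hI v hv
  have hvi := hwf.pos_inv_lt hv.1
  have hvl := pos_lt_length hv.1.1
  rcases hv.mem_Enq_or_null with he | ⟨-, hn⟩
  · have h1 := hs.enq_left he.1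
    by_cases h : ∃ d ∈ Deq c, d.val = v.val
    · obtain ⟨d, hd, hdv⟩ := h
      have h2 := hs.dequeued he.1 d hd hdv
      have h3 := pos_enq_inv_le hwf hf he hd hdv
      have h4 := hwf.pos_inv_lt hd.2
      omega
    · have h2 := hs.not_dequeued he.1 h
      omega
  · obtain ⟨k, h⟩ := hs.null hn
    omega

/-- If `v` is an enqueue whose response comes before the start of `w`, the absence of VOrd (for `w`
a dequeued enqueue) or the emptiness condition at the gap (for `w` a NULL dequeue) yields a dequeue
of `v` invoked early enough. If instead `e₂ v` is cut off by the response of the dequeue of `v`,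
that dequeue is already over when `w` may start. The other cases compare endpoints. -/
theorem interval_compatible (ho : ¬ VOrd c) {v w : Event} (hv : IsItem c v) (hw : IsItem c w)
    (hlt : e₂ v < e₁ w) : d₁ v ≤ d₂ w := by
  have hsv := hI v hv
  have hsw := hI w hw
  have hvi := hwf.pos_inv_lt hv.1
  have hwi := hwf.pos_inv_lt hw.1
  have hvl := pos_lt_length hv.1.1
  have hwl := pos_lt_length hw.1.1
  rcases hw.mem_Enq_or_null with hew | ⟨-, hnw⟩
  · have hw1 := hsw.enq_left hew.1
    by_cases hdw : ∃ d ∈ Deq c, d.val = w.val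
    · obtain ⟨dw, hdw, hdwv⟩ := hdw
      have hw2 := hsw.dequeued hew.1 dw hdw hdwv
      have hw3 := pos_enq_inv_le hwf hf hew hdw hdwv
      rcases hv.mem_Enq_or_null with hev | ⟨-, hnv⟩
      · have hord : pos c v.res < pos c w.inv →
            ∃ dv ∈ Deq c, dv.val = v.val ∧ pos c dv.inv ≤ pos c dw.res := by
          intro hp
          by_contra hcon
          push Not at hcon
          have hpr := (precedes_iff hwf.nodup hev.2.2 hew.2.1).2 hp
          obtain ⟨y, hy⟩ : ∃ y, v.val = some y := by
            rcases v with ⟨u, y⟩ | _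
            exacts [⟨y, rfl⟩, hev.1.elim]
          obtain ⟨x, hx⟩ : ∃ x, w.val = some x := by
            rcases w with ⟨u, y⟩ | _
            exacts [⟨y, rfl⟩, hew.1.elim]
          refine ho ⟨x, y, v, hev, w, hew, dw, hdw, hy, hx, hdwv.trans hx, hpr, ?_⟩
          by_cases h : ∃ dy ∈ Deq c, dy.val = some y
          · obtain ⟨dy, hdy, hdyv⟩ := h
            exact .inr ⟨dy, hdy, hdyv, (precedes_iff hwf.nodup hdw.2.2 hdy.2.1).2
              (hcon dy hdy (hdyv.trans hy.symm))⟩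
          · exact .inl h
        by_cases hdv : ∃ d ∈ Deq c, d.val = v.val
        · obtain ⟨dv, hdv, hdvv⟩ := hdv
          have hv2 := hsv.dequeued hev.1 dv hdv hdvv
          have hv3 := pos_enq_inv_le hwf hf hev hdv hdvv
          have hv4 := hwf.pos_inv_lt hdv.2
          by_cases hp : pos c v.res < pos c w.inv
          · obtain ⟨d', hd', hdv', hle⟩ := hord hp
            have hv2' := hsv.dequeued hev.1 d' hd' hdv'
            omega
          · omega
        · have hv2 := hsv.not_dequeued hev.1 hdv
          obtain ⟨d', hd', hdv', -⟩ := hord (by omega)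
          exact (hdv ⟨d', hd', hdv'⟩).elim
      · obtain ⟨k, h⟩ := hsv.null hnv
        omega
    · have hw2 := hsw.not_dequeued hew.1 hdw
      rcases hv.mem_Enq_or_null with hev | ⟨-, hnv⟩
      · by_cases hdv : ∃ d ∈ Deq c, d.val = v.val
        · obtain ⟨dv, hdv, hdvv⟩ := hdv
          have hv2 := hsv.dequeued hev.1 dv hdv hdvv
          have hv4 := pos_lt_length hdv.2.1
          omega
        · have hv2 := hsv.not_dequeued hev.1 hdv
          omega
      · obtain ⟨k, h⟩ := hsv.null hnv
        have := pos_lt_length hv.1.2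
        omega
  · obtain ⟨k, hk⟩ := hsw.null hnw
    rcases hv.mem_Enq_or_null with hev | ⟨-, hnv⟩
    · by_cases hdv : ∃ d ∈ Deq c, d.val = v.val
      · obtain ⟨dv, hdv, hdvv⟩ := hdv
        have hv2 := hsv.dequeued hev.1 dv hdv hdvv
        have hv3 := pos_enq_inv_le hwf hf hev hdv hdvv
        have hv4 := hwf.pos_inv_lt hdv.2
        by_cases hp : pos c v.res < k
        · obtain ⟨d', hd', hdv', hle⟩ := hk.2.2.2.2.2.2 v hev hp
          have hv2' := hsv.dequeued hev.1 d' hd' hdv'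
          omega
        · omega
      · have hv2 := hsv.not_dequeued hev.1 hdv
        obtain ⟨d', hd', hdv', -⟩ := hk.2.2.2.2.2.2 v hev (by omega)
        exact (hdv ⟨d', hd', hdv'⟩).elim
    · obtain ⟨k', h⟩ := hsv.null hnv
      omega

end

/-- The data from which a linearization is read off: the rank of every item in the order of the
queue, and points for its enqueue and its dequeue. -/
theorem exists_ranked_points (hwf : WellFormed c) (hf : ¬ VFresh c) (hr : ¬ VRepet c)
    (ho : ¬ VOrd c) (hw : ¬ VWit c) :
    ∃ rank tE tD : Event → ℕ,
      (∀ v w, IsItem c v → IsItem c w → rank v = rank w → v = w) ∧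
      (∀ v w, IsItem c v → IsItem c w → rank v ≤ rank w → tE v ≤ tE w ∧ tD v ≤ tD w) ∧
      (∀ v, IsItem c v → tE v ≤ tD v ∧ 2 * pos c v.inv + 1 ≤ tE v ∧ tE v ≤ 2 * pos c v.res + 1) ∧
      (∀ v, IsItem c v → v.val = none → tD v = tE v) ∧
      (∀ v ∈ Enq c, ∀ d ∈ Deq c, d.val = v.val →
        2 * pos c d.inv + 1 ≤ tD v ∧ tD v ≤ 2 * pos c d.res + 1) ∧
      (∀ v ∈ Enq c, (¬ ∃ d ∈ Deq c, d.val = v.val) → tD v = 2 * c.length) := by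
  classical
  choose! e₁ e₂ d₁ d₂ hI using fun v (hv : IsItem c v) => exists_intervals hwf hr hw hv
  have hfin : {v | IsItem c v}.Finite := (finite_completed hwf).subset fun v hv => hv.1
  have hmem : ∀ v, v ∈ hfin.toFinset ↔ IsItem c v := by simp
  obtain ⟨rank, tE, tD, hinj, hpt, hmono⟩ := exists_schedule hfin.toFinset e₁ e₂ d₁ d₂
    (fun v hv => (interval_bounds hwf hf hI ((hmem v).1 hv)).1)
    (fun v hv => (interval_bounds hwf hf hI ((hmem v).1 hv)).2.1)
    (fun v hv => (interval_bounds hwf hf hI ((hmem v).1 hv)).2.2)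
    (fun v hv w hw => interval_compatible hwf hf hI ho ((hmem v).1 hv) ((hmem w).1 hw))
  have hEi : ∀ v ∈ Enq c, IsItem c v := fun v hv => ⟨hv.2, .inl hv.1⟩
  refine ⟨rank, tE, tD, fun v w hv hw h => hinj (by simpa using hv) (by simpa using hw) h,
    fun v w hv hw => hmono v ((hmem v).2 hv) w ((hmem w).2 hw), fun v hv => ?_,
    fun v hv hn => ?_, fun v hv d hd hdv => ?_, fun v hv hnd => ?_⟩
  · have h1 := hpt v ((hmem v).2 hv)
    refine ⟨h1.2.2.2.2, ?_⟩
    rcases hv.mem_Enq_or_null with he | ⟨-, hn⟩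
    · have h2 := (hI v hv).enq_left he.1
      by_cases h : ∃ d ∈ Deq c, d.val = v.val
      · obtain ⟨d, hd, hdv⟩ := h
        have h3 := (hI v hv).dequeued he.1 d hd hdv
        omega
      · have h3 := (hI v hv).not_dequeued he.1 h
        omega
    · obtain ⟨k, hk⟩ := (hI v hv).null hn
      omega
  · have h1 := hpt v ((hmem v).2 hv)
    obtain ⟨k, hk⟩ := (hI v hv).null hn
    omega
  · have h1 := hpt v ((hmem v).2 (hEi v hv))
    have h3 := (hI v (hEi v hv)).dequeued hv.1 d hd hdv
    omega
  · have h1 := hpt v ((hmem v).2 (hEi v hv))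
    have h3 := (hI v (hEi v hv)).not_dequeued hv.1 hnd
    omega

/-! ### Reading the linearization off the schedule -/

/-- A dequeue of a number is attached to the enqueue of that number, which exists in the absence of
VFresh. The last clause makes the later choice return every item itself. -/
theorem exists_item (hf : ¬ VFresh c) {o : Event} (ho : Completed c o) :
    ∃ v, IsItem c v ∧ v.val = o.val ∧ (IsItem c o → v = o) := by
  by_cases h : IsItem c o
  · exact ⟨o, h, rfl, fun _ => rfl⟩
  rcases o with ⟨u, x⟩ | ⟨u, _ | x⟩
  · exact (h ⟨ho, .inl trivial⟩).elim
  · exact (h ⟨ho, .inr rfl⟩).elim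
  · by_contra hcon
    refine hf ⟨x, _, deq_mem_Deq.2 ho, rfl, .inl ?_⟩
    rintro ⟨e, he, hex⟩
    exact hcon ⟨e, ⟨he.2, .inl he.1⟩, hex, fun h' => (h h').elim⟩

theorem linearizable_of_not_violations (hwf : WellFormed c) (hcomplete : Complete c)
    (honce : EnqueuedAtMostOnce c) (hf : ¬ VFresh c) (hr : ¬ VRepet c)
    (ho : ¬ VOrd c) (hw : ¬ VWit c) : Linearizable queueBehaviors c := by
  classical
  obtain ⟨rank, tE, tD, hinj, hmono, hE, hN, hD, hU⟩ := exists_ranked_points hwf hf hr ho hw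
  choose! item hitem hval hself using fun o (h : Completed c o) => exists_item hf h
  -- A NULL dequeue uses its enqueue point, which equals its dequeue point. In the key, `rank` comes
  -- before `kind` so that ties in time respect the queue order; `kind` only places an enqueue
  -- before its own dequeue.
  let time : Event → ℕ := fun o => if IsItem c o then tE o else tD (item o)
  let kind : Event → ℕ := fun o => if IsItem c o then 0 else 1
  let key : Event → ℕ ×ₗ ℕ ×ₗ ℕ :=
    fun o => toLex (time o, toLex (rank (item o), kind o))
  have hEi : ∀ {u x}, Completed c (.enq u x) → IsItem c (.enq u x) := fun h => ⟨h, .inl trivial⟩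
  have hNi : ∀ {u}, Completed c (.deq u none) → IsItem c (.deq u none) := fun h => ⟨h, .inr rfl⟩
  have hDi : ∀ {u x}, ¬ IsItem c (.deq u (some x)) := fun h => by
    simpa [Event.IsEnq, Event.val] using h.2
  have hDitem : ∀ {u w x}, Completed c (.deq u (some x)) → Completed c (.enq w x) →
      item (.deq u (some x)) = .enq w x := fun {u w x} hd he => by
    have h1 := hval _ hd
    rcases (hitem _ hd).mem_Enq_or_null with h | ⟨-, h⟩
    · exact honce _ h _ (enq_mem_Enq.2 he) h1
    · rw [h1] at h; simp [Event.val] at h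
  have hDenq : ∀ {u x}, Completed c (.deq u (some x)) → ∃ w, Completed c (.enq w x) :=
    fun {u x} hd => by
      rcases (hitem _ hd).mem_Enq_or_null with h | ⟨-, h⟩
      · obtain ⟨w, hw⟩ := exists_eq_enq h (hval _ hd)
        exact ⟨w, hw ▸ h.2⟩
      · rw [hval _ hd] at h; simp [Event.val] at h
  have hDuniq : ∀ {u u' x}, Completed c (.deq u (some x)) → Completed c (.deq u' (some x)) →
      u = u' := fun {u u' x} hd hd' => by
    by_contra hne
    exact hr ⟨_, deq_mem_Deq.2 hd, _, deq_mem_Deq.2 hd', by simpa using hne, rfl,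
      by simp [Event.val]⟩
  have key_lt : ∀ {o o'}, key o < key o' ↔ time o < time o' ∨ time o = time o' ∧
      (rank (item o) < rank (item o') ∨ rank (item o) = rank (item o') ∧ kind o < kind o') := by
    intro o o'
    simp [key, Prod.Lex.toLex_lt_toLex]
  have key_item : ∀ {v w}, IsItem c v → IsItem c w → (key v < key w ↔ rank v < rank w) := by
    intro v w hv hw
    have h1 := hmono v w hv hw
    have h2 := hmono w v hw hv
    rw [key_lt]
    simp only [time, kind, if_pos hv, if_pos hw, hself _ hv.1 hv, hself _ hw.1 hw]
    omega
  have key_deq : ∀ {u w u' w' x y}, Completed c (.deq u (some x)) → Completed c (.enq w x) →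
      Completed c (.deq u' (some y)) → Completed c (.enq w' y) →
      rank (.enq w x) < rank (.enq w' y) → key (.deq u (some x)) < key (.deq u' (some y)) := by
    intro u w u' w' x y hd he hd' he' hlt
    have h1 := hmono _ _ (hEi he) (hEi he') hlt.le
    rw [key_lt]
    simp only [time, kind, if_neg hDi, hDitem hd he, hDitem hd' he']
    omega
  have key_enq_deq : ∀ {u w x}, Completed c (.deq u (some x)) → Completed c (.enq w x) →
      key (.enq w x) < key (.deq u (some x)) := by
    intro u w x hd he
    have h1 := hE _ (hEi he)
    rw [key_lt]
    simp only [time, kind, if_neg hDi, if_pos (hEi he), hDitem hd he, hself _ he (hEi he),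
      zero_lt_one, and_self, or_true, and_true]
    omega
  have key_deq_null : ∀ {u w x n}, Completed c (.deq u (some x)) → Completed c (.enq w x) →
      Completed c (.deq n none) → rank (.enq w x) < rank (.deq n none) →
      key (.deq u (some x)) < key (.deq n none) := by
    intro u w x n hd he hn hlt
    have h1 := hmono _ _ (hEi he) (hNi hn) hlt.le
    have h2 := hN _ (hNi hn) rfl
    rw [key_lt]
    simp only [time, kind, if_neg hDi, if_pos (hNi hn), hDitem hd he, hself _ hn (hNi hn)]
    omega
  have time_mem : ∀ o, Completed c o →
      2 * pos c o.inv + 1 ≤ time o ∧ time o ≤ 2 * pos c o.res + 1 := by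
    intro o h
    by_cases hi : IsItem c o
    · simp only [time, if_pos hi]
      exact (hE o hi).2
    · rcases o with ⟨u, x⟩ | ⟨u, _ | x⟩
      · exact (hi (hEi h)).elim
      · exact (hi (hNi h)).elim
      · obtain ⟨w, hw⟩ := hDenq h
        simp only [time, if_neg hDi, hDitem h hw]
        exact hD _ (enq_mem_Enq.2 hw) _ (deq_mem_Deq.2 h) rfl
  have key_inj : ∀ o, Completed c o → ∀ o', Completed c o' → key o = key o' → o = o' := by
    intro o h o' h' hk
    simp only [key, EmbeddingLike.apply_eq_iff_eq, Prod.mk.injEq] at hk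
    have hit := hinj _ _ (hitem _ h) (hitem _ h') hk.2.1
    have hkind : IsItem c o ↔ IsItem c o' := by
      have := hk.2.2
      by_cases h1 : IsItem c o <;> by_cases h2 : IsItem c o' <;> simp [kind, h1, h2] at this ⊢
    by_cases hi : IsItem c o
    · rw [← hself _ h hi, ← hself _ h' (hkind.1 hi), hit]
    · have hi' := mt hkind.2 hi
      have hv : o.val = o'.val := by rw [← hval _ h, ← hval _ h', hit]
      rcases o with ⟨u, x⟩ | ⟨u, _ | x⟩
      · exact (hi (hEi h)).elim
      · exact (hi (hNi h)).elim
      rcases o' with ⟨u', x'⟩ | ⟨u', _ | x'⟩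
      · exact (hi' (hEi h')).elim
      · exact (hi' (hNi h')).elim
      obtain rfl : x = x' := by simpa [Event.val] using hv
      rw [hDuniq h h']
  have hfin := finite_completed hwf
  obtain ⟨b, hb, hmem⟩ := exists_sorted_list hfin.toFinset key
    fun o h o' h' => key_inj o (by simpa using h) o' (by simpa using h')
  have hmem : ∀ o, o ∈ b ↔ Completed c o := fun o => by rw [hmem]; simp
  have hpre : ∀ {p r a}, b = p ++ a :: r → ∀ {o}, o ∈ p ↔ Completed c o ∧ key o < key a :=
    fun {p r a} h {o} => by rw [mem_prefix_iff_of_pairwise hb h, hmem]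
  have hmid : ∀ {p r a}, b = p ++ a :: r → Completed c a := fun {p r a} h =>
    (hmem a).1 (by simp [h])
  have hbb : b.Nodup := hb.imp fun h h' => by rw [h'] at h; exact lt_irrefl _ h
  have hdeqd : ∀ {w y}, Completed c (.enq w y) → tD (.enq w y) ≠ 2 * c.length →
      ∃ u, Completed c (.deq u (some y)) := by
    intro w y hy hne
    by_contra hcon
    refine hne (hU _ (enq_mem_Enq.2 hy) ?_)
    rintro ⟨d, hd, hdv⟩
    obtain ⟨u, rfl⟩ := exists_eq_deq hd hdv
    exact hcon ⟨u, hd.2⟩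
  refine linearizable_of_order hwf hcomplete (run_of_prefix_conditions ?_ ?_ ?_) hbb hmem ?_
  · intro p r u x hp hx
    obtain ⟨u', hu'⟩ := mem_deqs.1 hx
    have h1 := (hpre hp).1 hu'
    exact h1.2.asymm (key_enq_deq h1.1 (hmid hp))
  · intro p r u x hp
    have hd := hmid hp
    obtain ⟨w, hw⟩ := hDenq hd
    refine ⟨fun hx => ?_, ?_⟩
    · obtain ⟨u', hu'⟩ := mem_deqs.1 hx
      have h1 := (hpre hp).1 hu'
      obtain rfl := hDuniq hd h1.1
      exact lt_irrefl _ h1.2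
    · have hwp : .enq w x ∈ p := (hpre hp).2 ⟨hw, key_enq_deq hd hw⟩
      obtain ⟨p₁, p₂, rfl⟩ := List.append_of_mem hwp
      have hp' : b = p₁ ++ .enq w x :: (p₂ ++ .deq u (some x) :: r) := by simp [hp]
      refine ⟨enqs p₁, enqs p₂, by simp, fun y hy => ?_, fun hx => ?_⟩
      · obtain ⟨w', hw'⟩ := mem_enqs.1 hy
        obtain ⟨hy', hlt⟩ := (hpre hp').1 hw'
        rw [key_item (hEi hy') (hEi hw)] at hlt
        have h1 := hmono _ _ (hEi hy') (hEi hw) hlt.le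
        have h2 := hD _ (enq_mem_Enq.2 hw) _ (deq_mem_Deq.2 hd) rfl
        have h3 := pos_lt_length hd.2
        -- The dequeue point of `y` is at most that of `x`, which lies below the time `2 * c.length`
        -- reserved for values never dequeued.
        obtain ⟨u', hu'⟩ := hdeqd hy' (by omega)
        exact mem_deqs.2 ⟨u', (hpre hp).2 ⟨hu', key_deq hu' hy' hd hw hlt⟩⟩
      · obtain ⟨w', hw'⟩ := mem_enqs.1 hx
        have hc' : Completed c (.enq w' x) := (hmem _).1 (by simp [hp', hw'])
        have heq := honce _ (enq_mem_Enq.2 hc') _ (enq_mem_Enq.2 hw) rfl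
        rw [heq] at hw'
        have := hbb
        rw [hp', List.nodup_append, List.nodup_cons] at this
        exact this.2.1.1 (by simp [hw'])
  · intro p r n hp y hy
    have hn := hmid hp
    obtain ⟨w, hw⟩ := mem_enqs.1 hy
    obtain ⟨hy', hlt⟩ := (hpre hp).1 hw
    rw [key_item (hEi hy') (hNi hn)] at hlt
    have h1 := hmono _ _ (hEi hy') (hNi hn) hlt.le
    have h2 := hE _ (hNi hn)
    have h3 := hN _ (hNi hn) rfl
    have h4 := pos_lt_length hn.2
    -- Likewise, the dequeue point of `y` is bounded by the point of the NULL dequeue, which lies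
    -- below `2 * c.length`.
    obtain ⟨u, hu⟩ := hdeqd hy' (by omega)
    exact mem_deqs.2 ⟨u, (hpre hp).2 ⟨hu, key_deq_null hu hy' hn hlt⟩⟩
  · intro p r e e' hp he hpr
    have h := (hmem e).1 he
    have h' := hmid hp
    rw [precedes_iff hwf.nodup h.2 h'.1] at hpr
    have h1 := time_mem e h
    have h2 := time_mem e' h'
    -- Each time lies between the invocation and the response of its event, so real-time precedence
    -- forces strictly increasing times.
    exact (hpre hp).2 ⟨h, key_lt.2 (.inl (by omega))⟩

end Sufficiency

end QueueLin

theorem mainTheorem2 (c : QueueLin.History) (hwf : QueueLin.WellFormed c)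
    (hcomplete : QueueLin.Complete c) (honce : QueueLin.EnqueuedAtMostOnce c) :
    QueueLin.Linearizable QueueLin.queueBehaviors c ↔
      ¬ QueueLin.VFresh c ∧ ¬ QueueLin.VRepet c ∧ ¬ QueueLin.VOrd c ∧ ¬ QueueLin.VWit c :=
  ⟨fun h => h.not_violations hwf hcomplete honce, fun ⟨hf, hr, ho, hw⟩ =>
    QueueLin.linearizable_of_not_violations hwf hcomplete honce hf hr ho hw⟩
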